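/- All groups are additively written and abelian. A group $G$ is called generalized co-Bassian if, for every subgroup $N\le G$ and every injective homomorphism $\phi:G\to G/N$, the image $\phi(G)$ is a direct summand of $G/N$. A group is called super generalized co-Bassian if all of its factor groups are generalized co-Bassian. The $p$-rank of a group $A$, for a prime $p$, is the dimension over $\mathbb{Z}/p\mathbb{Z}$ of $A[p]=\{x\in A : px=0\}$; the rank of a torsion-free group is the maximal cardinality of a $\mathbb{Z}$-linearly independent subset. Theorem. Let $G$ be an abelian group with torsion subgroup $T$ and, for each prime $p$, let $T_p$ be the $p$-torsion subgroup of $G$, that is, the set of elements of $G$ whose order is a power of $p$. Then $G$ is super generalized co-Bassian if and only if one of the following two conditions holds: (a) $G$ is divisible; (b) $G/T$ is torsion-free divisible of finite rank and, for each prime $p$, either $T_p$ is divisible or $pT_p$ has finite $p$-rank. -/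

import Mathlib

/-- An abelian group is divisible if division by every nonzero integer is possible in it. -/
def IsDivisibleGroup (G : Type*) [AddCommGroup G] : Prop :=
  Nonempty (DivisibleBy G ℤ)

/-- A subgroup is a direct summand if it has a complementary subgroup. -/
def IsDirectSummand {G : Type*} [AddCommGroup G] (H : AddSubgroup G) : Prop :=
  ∃ C : AddSubgroup G, IsCompl H C

/-- `G` is generalized co-Bassian if for every subgroup `N`, the image of every injective
homomorphism `G → G / N` is a direct summand of `G / N`. -/
def IsGeneralizedCoBassian (G : Type*) [AddCommGroup G] : Prop :=
  ∀ (N : AddSubgroup G) (φ : G →+ G ⧸ N), Function.Injective φ → IsDirectSummand φ.range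

/-- `G` is super generalized co-Bassian if all its factor groups are generalized co-Bassian. -/
def IsSuperGeneralizedCoBassian (G : Type*) [AddCommGroup G] : Prop :=
  ∀ K : AddSubgroup G, IsGeneralizedCoBassian (G ⧸ K)

/-- Finite (torsion-free) rank: the supremum of the cardinalities of the `ℤ`-linearly
independent families in `G` is finite. -/
def HasFiniteRank (G : Type*) [AddCommGroup G] : Prop :=
  Module.rank ℤ G < Cardinal.aleph0

/-- The `p`-rank of `G`: the dimension over `ℤ / p` of the socle `G[p] = {x | p x = 0}`. -/
noncomputable def pRank (p : ℕ) (G : Type*) [AddCommGroup G] : Cardinal :=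
  letI : Module (ZMod p) (AddSubgroup.torsionBy G (p : ℤ)) := AddSubgroup.torsionBy.zmodModule
  Module.rank (ZMod p) (AddSubgroup.torsionBy G (p : ℤ))

/-- `G` has finite `p`-rank. -/
def HasFinitePRank (p : ℕ) (G : Type*) [AddCommGroup G] : Prop :=
  pRank p G < Cardinal.aleph0

/-- The subgroup `n G = {n x | x ∈ G}`. -/
def multiplesSubgroup (n : ℕ) (G : Type*) [AddCommGroup G] : AddSubgroup G :=
  (nsmulAddMonoidHom n : G →+ G).range

/-! Sufficiency. Divisible groups pass (a) to their images, and divisible subgroups are summands.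
Under (b), let `B` be a quotient of `G`, `π : B → A` onto and `φ : B → A` injective. Dividing `A` by
a subgroup `C` maximal among those disjoint from `φ(B)` makes the image of `φ` essential; if `φ` is
then onto, `C` is a complement of `φ(B)` (`IsFiniteRankMixed.isDirectSummand_range`). Surjectivity
is proved in `IsFiniteRankMixed.surjective_of_essential`. Finite rank makes `ker π` and `coker φ`
torsion. For each prime `p`, either `B` is `p`-divisible or the `p`-component of `pB` is Artinian;
in the latter case the dual of Orzech's theorem makes `φ` onto the `p`-component of `pA`.
Essentiality supplies the socle, so all torsion of `A` is in the image, and divisibility modulo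
torsion gives the rest.

Necessity. Summands are pure, so no embedding of an image `M × ℤ/p` of `G` into one of its own
quotients can make the generator of `ℤ/p` divisible by `p`
(`IsSuperGeneralizedCoBassian.false_of_divisible_image`). With `M` a divisible `p`-group of infinite
socle, this shows that divisible images of a `G` that is not `p`-divisible have finite `p`-rank,
hence that `G/T` has finite rank. With `M` free of infinite rank over `ℤ/p²`, it shows that `pP/p²P`
is finite, where `P = T_p`. Hence some `p^(k+1) P` is divisible, so of finite `p`-rank, and `pP`
exceeds it by a finite group only. -/

open Function

universe u

/-! ### Artinian modules and `p`-groups with finite socle. -/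

/-- A surjection and an injection between the same modules, the source being Artinian: the
injection is then surjective. This is dual to Orzech's theorem. -/
theorem IsArtinian.surjective_of_surjective_of_injective {R M N : Type*} [Ring R]
    [AddCommGroup M] [Module R M] [AddCommGroup N] [Module R N] [IsArtinian R M]
    (i π : M →ₗ[R] N) (hi : Injective i) (hπ : Surjective π) : Surjective i := by
  -- The operation `J ↦ π⁻¹(i(J))` is injective on submodules, so an equality `I (n + 1) = I n`
  -- descends to `I 1 = I 0`, that is, `π⁻¹(range i) = ⊤`.
  let I : ℕ → Submodule R M := fun n => Nat.rec ⊤ (fun _ J => (J.map i).comap π) n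
  have hI : ∀ n, I (n + 1) = ((I n).map i).comap π := fun n => rfl
  have hanti : ∀ n, I (n + 1) ≤ I n := by
    intro n
    induction n with
    | zero => exact le_top
    | succ n ih =>
      rw [hI (n + 1), hI n]
      exact Submodule.comap_mono (Submodule.map_mono ih)
  obtain ⟨n, hn⟩ := IsArtinian.monotone_stabilizes
    (⟨fun n => OrderDual.toDual (I n), monotone_nat_of_le_succ hanti⟩ : ℕ →o (Submodule R M)ᵒᵈ)
  have hdown : ∀ n, I (n + 1) = I n → I 1 = I 0 := by
    intro n
    induction n with
    | zero => exact id
    | succ n ih =>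
      intro h
      refine ih ?_
      rw [hI (n + 1), hI n] at h
      exact Submodule.map_injective_of_injective hi (Submodule.comap_injective_of_surjective hπ h)
  have h1 : I 1 = ⊤ := hdown n (hn (n + 1) n.le_succ).symm
  intro y
  obtain ⟨x, rfl⟩ := hπ y
  have hx : x ∈ I 1 := h1 ▸ Submodule.mem_top
  obtain ⟨z, -, hz⟩ := hx
  exact ⟨z, hz⟩

theorem exists_forall_ge_inter_eq {α : Type*} {F : Set α} (hF : F.Finite) (S : ℕ → Set α)
    (hS : Antitone S) : ∃ m, ∀ n, m ≤ n → F ∩ S n = F ∩ S m := by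
  have := hF.to_subtype
  obtain ⟨m, hm⟩ := WellFoundedGT.monotone_chain_condition
    (⟨fun n => OrderDual.toDual {x : F | (x : α) ∈ S n}, fun a b hab => by
      rw [OrderDual.toDual_le_toDual]
      exact fun x hx => hS hab hx⟩ : ℕ →o (Set F)ᵒᵈ)
  refine ⟨m, fun n hn => ?_⟩
  have := hm n hn
  change ((↑) ⁻¹' S m : Set F) = (↑) ⁻¹' S n at this
  rw [Subtype.preimage_coe_eq_preimage_coe_iff] at this
  exact this.symm

theorem finite_setOf_pow_nsmul_eq_zero {P : Type*} [AddCommGroup P] {p : ℕ}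
    (h : {x : P | p • x = 0}.Finite) (k : ℕ) : {x : P | p ^ k • x = 0}.Finite := by
  induction k with
  | zero => simp
  | succ k ih =>
    have hsub : {x : P | p ^ (k + 1) • x = 0} ⊆ ⋃ y ∈ {y : P | p ^ k • y = 0}, {x | p • x = y} := by
      intro x hx
      simp only [Set.mem_ofPred_eq, Set.mem_iUnion, exists_prop, exists_eq_right', pow_succ,
        mul_nsmul'] at hx ⊢
      exact hx
    refine (ih.biUnion fun y _ => ?_).subset hsub
    rcases Set.eq_empty_or_nonempty {x : P | p • x = y} with he | ⟨x₀, hx₀⟩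
    · rw [he]; exact Set.finite_empty
    · refine (h.image (x₀ + ·)).subset fun x hx => ⟨x - x₀, ?_, by simp⟩
      simp only [Set.mem_ofPred_eq] at hx hx₀ ⊢
      rw [nsmul_sub, hx, hx₀, sub_self]

/-- An abelian `p`-group with finite socle is Artinian. -/
theorem isArtinian_of_finite_socle {P : Type*} [AddCommGroup P] {p : ℕ}
    (hP : ∀ x : P, ∃ k : ℕ, p ^ k • x = 0) (h : {x : P | p • x = 0}.Finite) :
    IsArtinian ℤ P := by
  rw [← monotone_stabilizes_iff_artinian]
  intro f
  let Q : ℕ → Submodule ℤ P := fun n => OrderDual.ofDual (f n)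
  have hQ : Antitone Q := fun a b hab => f.monotone hab
  -- `S n i` is `p ^ n Q_i`. The socles of the diagonal terms `p ^ n Q_n` lie in a finite set, so
  -- they are constant from some `m` on.
  let S : ℕ → ℕ → Set P := fun n i => {x | ∃ y ∈ Q i, x = p ^ n • y}
  have hS : ∀ n n' i i', n ≤ n' → i ≤ i' → S n' i' ⊆ S n i := by
    rintro n n' i i' hn hi x ⟨y, hy, rfl⟩
    refine ⟨p ^ (n' - n) • y, (Q i).nsmul_mem (hQ hi hy) _, ?_⟩
    rw [← mul_nsmul', ← pow_add, Nat.add_sub_cancel' hn]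
  obtain ⟨m, hm⟩ := exists_forall_ge_inter_eq h (fun n => S n n) fun a b hab => hS _ _ _ _ hab hab
  have hstab : ∀ n i, m ≤ n → m ≤ i → {x : P | p • x = 0} ∩ S n m ⊆ S n i := by
    intro n i hn hi x hx
    have h1 : x ∈ {x : P | p • x = 0} ∩ S m m := ⟨hx.1, hS _ _ _ _ hn le_rfl hx.2⟩
    rw [← hm (max n i) (hn.trans (le_max_left _ _))] at h1
    exact hS _ _ _ _ (le_max_left _ _) (le_max_right _ _) h1.2
  -- This gives `p ^ m Q_m ⊆ p ^ m Q_i`: the multiple `p ^ (m + k) • q` lies in the socle, hence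
  -- comes from some `r ∈ Q_i`, and `p ^ m • (q - r)` has smaller order.
  have key : ∀ i, m ≤ i → ∀ k, ∀ q ∈ Q m, p ^ k • p ^ m • q = 0 →
      ∃ q' ∈ Q i, p ^ m • q = p ^ m • q' := by
    intro i hi k
    induction k with
    | zero =>
      intro q _ h0
      exact ⟨0, (Q i).zero_mem, by simpa using h0⟩
    | succ k ih =>
      intro q hq h0
      obtain ⟨r, hr, hqr⟩ : p ^ (m + k) • q ∈ S (m + k) i := by
        refine hstab (m + k) i (Nat.le_add_right _ _) hi ⟨?_, q, hq, rfl⟩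
        rw [← mul_nsmul', ← pow_add] at h0
        rw [Set.mem_ofPred_eq, ← mul_nsmul', ← pow_succ', ← h0]
        congr 2; ring
      obtain ⟨s, hs, hqs⟩ := ih (q - r) ((Q m).sub_mem hq (hQ hi hr)) (by
        rw [← mul_nsmul', ← pow_add, nsmul_sub, add_comm k m, hqr, sub_self])
      refine ⟨r + s, (Q i).add_mem hr hs, ?_⟩
      rw [nsmul_add, ← hqs, nsmul_sub]; abel
  -- What remains is the `p ^ m`-torsion of `Q_n`, which sits in a finite set and so stabilizes too.
  obtain ⟨l, hl⟩ := exists_forall_ge_inter_eq (finite_setOf_pow_nsmul_eq_zero h m)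
    (fun n => (Q n : Set P)) fun a b hab => hQ hab
  refine ⟨max m l, fun n hn => ?_⟩
  have hmn := (le_max_left m l).trans hn
  have hln := (le_max_right m l).trans hn
  refine le_antisymm (α := Submodule ℤ P) (fun q hq => ?_) (hQ hn)
  obtain ⟨k, hk⟩ := hP (p ^ m • q)
  obtain ⟨r, hr, hqr⟩ := key n hmn k q (hQ (le_max_left m l) hq) hk
  have h1 : q - r ∈ {x : P | p ^ m • x = 0} ∩ (Q l : Set P) := by
    refine ⟨?_, (Q l).sub_mem (hQ (le_max_right m l) hq) (hQ hln hr)⟩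
    rw [Set.mem_ofPred_eq, nsmul_sub, hqr, sub_self]
  rw [← hl n hln] at h1
  exact (sub_add_cancel q r) ▸ (Q n).add_mem h1.2 hr

/-! ### Primary components of homomorphic images. -/

/-- The map induced on `p`-primary components. -/
def AddMonoidHom.primaryMap {A C : Type*} [AddCommGroup A] [AddCommGroup C] (f : A →+ C) (p : ℕ) :
    AddCommGroup.primaryComponent A p →+ AddCommGroup.primaryComponent C p :=
  (f.comp (AddCommGroup.primaryComponent A p).subtype).codRestrict _ (by
    rintro ⟨x, k, hk⟩
    exact ⟨k, by simpa [← map_nsmul] using congrArg f hk⟩)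

theorem AddMonoidHom.primaryMap_injective {A C : Type*} [AddCommGroup A] [AddCommGroup C]
    {f : A →+ C} (hf : Injective f) (p : ℕ) : Injective (f.primaryMap p) := fun _ _ h =>
  Subtype.ext (hf (congrArg Subtype.val h))

/-- If `a` lifts an element killed by `p ^ k`, then `p ^ k • a` is killed by some `p ^ j * r` with
`r` prime to `p`. A multiplier `u * r ≡ 1` modulo `p ^ k` makes `a` `p`-primary without changing its
image. -/
theorem AddMonoidHom.primaryMap_surjective {A C : Type*} [AddCommGroup A] [AddCommGroup C]
    {f : A →+ C} (hf : Surjective f) (hker : ∀ x, f x = 0 → ∃ n : ℕ, n ≠ 0 ∧ n • x = 0)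
    {p : ℕ} (hp : p.Prime) : Surjective (f.primaryMap p) := by
  rintro ⟨c, k, hk⟩
  obtain ⟨a, rfl⟩ := hf c
  obtain ⟨n, hn, hna⟩ := hker (p ^ k • a) (by simpa using hk)
  obtain ⟨j, r, hr, rfl⟩ := Nat.exists_eq_pow_mul_and_not_dvd hn p hp.ne_one
  have hcop : IsCoprime (r : ℤ) ((p ^ k : ℕ) : ℤ) :=
    Nat.isCoprime_iff_coprime.2 (((Nat.Prime.coprime_iff_not_dvd hp).2 hr).symm.pow_right k)
  obtain ⟨u, v, huv⟩ := hcop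
  refine ⟨⟨(u * r) • a, j + k, ?_⟩, Subtype.ext ?_⟩
  · rw [← natCast_zsmul, ← natCast_zsmul, ← mul_smul] at hna
    rw [← natCast_zsmul, ← mul_smul]
    have : ((p ^ (j + k) : ℕ) : ℤ) * (u * r) = u * (((p ^ j * r : ℕ) : ℤ) * (p ^ k : ℕ)) := by
      push_cast; ring
    rw [this, mul_smul, hna, smul_zero]
  · change f ((u * r) • a) = f a
    have h1 : f a = (u * r + v * ((p ^ k : ℕ) : ℤ)) • f a := by rw [huv, one_zsmul]
    have hk' : (p ^ k) • f a = 0 := hk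
    rw [h1, add_smul, mul_smul v, natCast_zsmul, hk', smul_zero, add_zero, map_zsmul]

theorem exists_fg_le_of_rank_lt_aleph0 {A : Type*} [AddCommGroup A]
    (hA : Module.rank ℤ A < Cardinal.aleph0) :
    ∃ F : Submodule ℤ A, F.FG ∧ ∀ x : A, ∃ n : ℤ, n ≠ 0 ∧ n • x ∈ F := by
  obtain ⟨s, hs, hli⟩ := exists_set_linearIndependent ℤ A
  refine ⟨Submodule.span ℤ s, ?_, fun x => ?_⟩
  · have : s.Finite := Cardinal.lt_aleph0_iff_set_finite.1 (hs ▸ hA)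
    exact ⟨this.toFinset, by simp⟩
  · have h1 := Submodule.rank_quotient_add_rank (Submodule.span ℤ s)
    rw [rank_span_set hli, hs] at h1
    have h2 : Module.rank ℤ (A ⧸ Submodule.span ℤ s) = 0 := by
      exact Cardinal.eq_of_add_eq_add_right (h1.trans (zero_add _).symm) hA
    obtain ⟨n, hn, h⟩ := rank_eq_zero_iff.1 h2 (Submodule.Quotient.mk x)
    exact ⟨n, hn, by rwa [← Submodule.Quotient.mk_smul, Submodule.Quotient.mk_eq_zero] at h⟩

/-- If `A` has finite `p`-socle, so does its quotient by a finitely generated subgroup. -/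
theorem finite_socle_quotient_of_fg {A : Type*} [AddCommGroup A] {p : ℕ} (hp : p ≠ 0)
    (h : {x : A | p • x = 0}.Finite) {F : Submodule ℤ A} (hF : F.FG) :
    {x : A ⧸ F | p • x = 0}.Finite := by
  let μ : A →ₗ[ℤ] A := LinearMap.lsmul ℤ A (p : ℤ)
  have hμ : ∀ x, μ x = p • x := fun x => by simp [μ]
  -- Multiplication by `p` maps this preimage of `F` into `F`, with finite kernel. Its image in `A ⧸
  -- F` is the socle, finitely generated and killed by `p`.
  have hS : (F.comap μ).FG := by
    refine Submodule.fg_of_fg_map_of_fg_inf_ker μ ?_ ?_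
    · have : IsNoetherian ℤ F := isNoetherian_of_fg_of_noetherian F hF
      exact Submodule.FG.of_le hF (Submodule.map_comap_le _ _)
    · have hfin : ((F.comap μ ⊓ LinearMap.ker μ : Submodule ℤ A) : Set A).Finite :=
        h.subset fun x hx => by simpa [hμ] using hx.2
      exact ⟨hfin.toFinset, by simp⟩
  have hT : ((F.comap μ).map F.mkQ).FG := hS.map _
  have : Module.Finite ℤ ((F.comap μ).map F.mkQ) := Module.Finite.iff_fg.2 hT
  have hfin : Finite ((F.comap μ).map F.mkQ) := by
    refine Module.finite_of_fg_torsion _ ?_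
    rintro ⟨_, x, hx, rfl⟩
    refine ⟨⟨p, by simpa using hp⟩, Subtype.ext ?_⟩
    change (p : ℤ) • F.mkQ x = 0
    rw [← map_smul]
    exact (Submodule.Quotient.mk_eq_zero F).2 hx
  refine (Set.toFinite ((F.comap μ).map F.mkQ : Set (A ⧸ F))).subset fun x hx => ?_
  obtain ⟨a, rfl⟩ := F.mkQ_surjective x
  refine ⟨a, ?_, rfl⟩
  have h1 : F.mkQ (p • a) = 0 := by rw [map_nsmul]; exact hx
  rw [SetLike.mem_coe, Submodule.mem_comap, hμ]
  exact (Submodule.Quotient.mk_eq_zero F).1 h1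

/-- If `A` has finite torsion-free rank and finite `p`-rank, then the `p`-primary component of
each homomorphic image of `A` is Artinian. -/
theorem isArtinian_primaryComponent_of_surjective {A C : Type*} [AddCommGroup A] [AddCommGroup C]
    {p : ℕ} (hp : p.Prime) (hA : Module.rank ℤ A < Cardinal.aleph0)
    (h : {x : A | p • x = 0}.Finite) {f : A →+ C} (hf : Surjective f) :
    IsArtinian ℤ (AddCommGroup.primaryComponent C p) := by
  obtain ⟨F, hF, hFt⟩ := exists_fg_le_of_rank_lt_aleph0
    ((Submodule.rank_le (LinearMap.ker f.toIntLinearMap)).trans_lt hA)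
  -- `f` factors through `A ⧸ F'`: the first quotient keeps the socle finite, and the second has
  -- torsion kernel, so it is onto on `p`-components.
  let F' : Submodule ℤ A := F.map (LinearMap.ker f.toIntLinearMap).subtype
  have hF' : F'.FG := hF.map _
  have hle : F' ≤ LinearMap.ker f.toIntLinearMap := Submodule.map_subtype_le _ _
  have hsoc := finite_socle_quotient_of_fg hp.ne_zero h hF'
  let g : A ⧸ F' →+ C := (F'.liftQ f.toIntLinearMap hle).toAddMonoidHom
  have hgf : ∀ a, g (F'.mkQ a) = f a := fun _ => rfl
  have hg : Surjective g := fun c => (hf c).imp' _ fun a ha => (hgf a).trans ha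
  have hker : ∀ x, g x = 0 → ∃ n : ℕ, n ≠ 0 ∧ n • x = 0 := by
    intro x hx
    obtain ⟨a, rfl⟩ := F'.mkQ_surjective x
    obtain ⟨n, hn, hna⟩ := hFt ⟨a, (hgf a).symm.trans hx⟩
    have h1 : n • F'.mkQ a = 0 := by
      rw [← map_smul]
      exact (Submodule.Quotient.mk_eq_zero F').2 ⟨_, hna, rfl⟩
    exact ⟨n.natAbs, Int.natAbs_ne_zero.2 hn, natAbs_nsmul_eq_zero.2 h1⟩
  have hs := g.primaryMap_surjective hg hker hp
  have : IsArtinian ℤ (AddCommGroup.primaryComponent (A ⧸ F') p) := by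
    refine isArtinian_of_finite_socle (p := p) ?_ ?_
    · rintro ⟨x, k, hk⟩
      exact ⟨k, Subtype.ext hk⟩
    · refine Set.Finite.of_finite_image (f := Subtype.val) (hsoc.subset ?_)
        Subtype.val_injective.injOn
      rintro _ ⟨x, hx, rfl⟩
      exact congrArg Subtype.val hx
  exact isArtinian_of_surjective _ (g.primaryMap p).toIntLinearMap hs

/-- The map induced on the subgroups of multiples of `n`. -/
def AddMonoidHom.multiplesMap {A C : Type*} [AddCommGroup A] [AddCommGroup C] (f : A →+ C)
    (n : ℕ) : multiplesSubgroup n A →+ multiplesSubgroup n C :=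
  (f.comp (multiplesSubgroup n A).subtype).codRestrict _ (by
    rintro ⟨_, x, rfl⟩
    exact ⟨f x, by simp⟩)

theorem AddMonoidHom.multiplesMap_injective {A C : Type*} [AddCommGroup A] [AddCommGroup C]
    {f : A →+ C} (hf : Injective f) (n : ℕ) : Injective (f.multiplesMap n) := fun _ _ h =>
  Subtype.ext (hf (congrArg Subtype.val h))

theorem AddMonoidHom.multiplesMap_surjective {A C : Type*} [AddCommGroup A] [AddCommGroup C]
    {f : A →+ C} (hf : Surjective f) (n : ℕ) : Surjective (f.multiplesMap n) := by
  rintro ⟨_, c, rfl⟩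
  obtain ⟨a, rfl⟩ := hf c
  exact ⟨⟨_, a, rfl⟩, Subtype.ext (map_nsmul f n a)⟩

/-! ### Embeddings into quotients for groups of finite rank. -/

/-- A convenient form of the second condition of the classification, inherited by quotients. -/
structure IsFiniteRankMixed (B : Type*) [AddCommGroup B] : Prop where
  rank_lt : Module.rank ℤ B < Cardinal.aleph0
  divisible_mod_torsion : ∀ n : ℕ, n ≠ 0 → ∀ b : B, ∃ c, ∃ m : ℕ, m ≠ 0 ∧ m • (b - n • c) = 0
  primary : ∀ p : ℕ, p.Prime → (∀ b : B, ∃ c, p • c = b) ∨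
    IsArtinian ℤ (AddCommGroup.primaryComponent (multiplesSubgroup p B) p)

section RankComparison

variable {A B : Type u} [AddCommGroup A] [AddCommGroup B]

theorem rank_eq_of_surjective_of_injective {π φ : B →+ A} (hπ : Surjective π)
    (hφ : Injective φ) : Module.rank ℤ A = Module.rank ℤ B :=
  le_antisymm (LinearMap.rank_le_of_surjective π.toIntLinearMap hπ)
    (LinearMap.rank_le_of_injective φ.toIntLinearMap hφ)

theorem exists_nsmul_eq_zero_of_surjective_of_injective
    (hB : Module.rank ℤ B < Cardinal.aleph0) {π φ : B →+ A} (hπ : Surjective π)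
    (hφ : Injective φ) (x : B) (hx : π x = 0) : ∃ n : ℕ, n ≠ 0 ∧ n • x = 0 := by
  have h1 := LinearMap.rank_range_add_rank_ker π.toIntLinearMap
  have h2 : LinearMap.range π.toIntLinearMap = ⊤ := LinearMap.range_eq_top.2 hπ
  rw [h2, rank_top, rank_eq_of_surjective_of_injective hπ hφ, add_comm] at h1
  have h5 : Module.rank ℤ (LinearMap.ker π.toIntLinearMap) = 0 :=
    Cardinal.eq_of_add_eq_add_right (h1.trans (zero_add _).symm) hB
  obtain ⟨n, hn, h⟩ := rank_eq_zero_iff.1 h5 ⟨x, hx⟩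
  exact ⟨n.natAbs, Int.natAbs_ne_zero.2 hn, natAbs_nsmul_eq_zero.2 (congrArg Subtype.val h)⟩

theorem exists_nsmul_mem_range_of_surjective_of_injective
    (hB : Module.rank ℤ B < Cardinal.aleph0) {π φ : B →+ A} (hπ : Surjective π)
    (hφ : Injective φ) (a : A) : ∃ n : ℕ, n ≠ 0 ∧ ∃ b, n • a = φ b := by
  have h1 := Submodule.rank_quotient_add_rank (LinearMap.range φ.toIntLinearMap)
  have h2 : Module.rank ℤ (LinearMap.range φ.toIntLinearMap) = Module.rank ℤ B :=
    rank_range_of_injective φ.toIntLinearMap hφ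
  rw [h2, rank_eq_of_surjective_of_injective hπ hφ] at h1
  have h5 := Cardinal.eq_of_add_eq_add_right (h1.trans (zero_add _).symm) hB
  obtain ⟨n, hn, h⟩ := rank_eq_zero_iff.1 h5 (Submodule.Quotient.mk a)
  rw [← Submodule.Quotient.mk_smul] at h
  obtain ⟨b, hb⟩ := (Submodule.Quotient.mk_eq_zero _).1 h
  have hb : φ b = n • a := hb
  refine ⟨n.natAbs, Int.natAbs_ne_zero.2 hn, ?_⟩
  rcases Int.natAbs_eq n with h | h
  · exact ⟨b, by rw [hb, ← natCast_zsmul, ← h]⟩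
  · refine ⟨-b, ?_⟩
    rw [map_neg, hb, ← natCast_zsmul, ← neg_smul]
    congr 1; omega

end RankComparison

theorem mem_of_essential_of_prime_nsmul_eq_zero {A : Type*} [AddCommGroup A] {H : AddSubgroup A}
    (hess : ∀ a : A, a ≠ 0 → ∃ n : ℤ, n • a ≠ 0 ∧ n • a ∈ H) {p : ℕ} (hp : p.Prime) {a : A}
    (ha : p • a = 0) : a ∈ H := by
  by_cases h0 : a = 0
  · exact h0 ▸ H.zero_mem
  obtain ⟨n, hn, hnH⟩ := hess a h0
  have hcop : IsCoprime n (p : ℤ) := by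
    refine ((Nat.prime_iff_prime_int.1 hp).irreducible.coprime_iff_not_dvd.2 ?_).symm
    rintro ⟨m, rfl⟩
    exact hn (by rw [mul_comm, mul_smul, natCast_zsmul, ha, smul_zero])
  obtain ⟨u, v, huv⟩ := hcop
  have : a = u • n • a := by
    rw [← mul_smul]
    nth_rw 1 [← one_smul ℤ a]
    rw [← huv, add_smul, mul_smul v, natCast_zsmul, ha, smul_zero, add_zero]
  rw [this]
  exact H.zsmul_mem hnH u

/-- A torsion element `t` is the sum of a multiple of `t` lying in the `p`-primary component and of
`p` times a multiple of `t`. -/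
theorem exists_primary_add_nsmul {A : Type*} [AddCommGroup A] {p : ℕ} (hp : p.Prime) {n : ℕ}
    (hn : n ≠ 0) {t : A} (ht : n • t = 0) :
    ∃ u v : ℤ, t = u • t + p • v • t ∧ u • t ∈ AddCommGroup.primaryComponent A p := by
  obtain ⟨k, r, hr, rfl⟩ := Nat.exists_eq_pow_mul_and_not_dvd hn p hp.ne_one
  have hcop : IsCoprime (r : ℤ) (p : ℤ) :=
    Nat.isCoprime_iff_coprime.2 ((Nat.Prime.coprime_iff_not_dvd hp).2 hr).symm
  obtain ⟨u, v, huv⟩ := hcop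
  refine ⟨u * r, v, ?_, k, ?_⟩
  · nth_rw 1 [← one_smul ℤ t]
    rw [← huv, add_smul, mul_comm v, mul_smul (p : ℤ), natCast_zsmul]
  · have : p ^ k • (u * (r : ℤ)) • t = u • (p ^ k * r) • t := by
      rw [← natCast_zsmul, ← natCast_zsmul, ← mul_smul, ← mul_smul]
      congr 1; push_cast; ring
    rw [this, ht, smul_zero]

/-- An embedding of a group of finite rank mixed type into one of its quotients is surjective as
soon as its image is essential. -/
theorem IsFiniteRankMixed.surjective_of_essential {A B : Type u} [AddCommGroup A] [AddCommGroup B]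
    (hB : IsFiniteRankMixed B) {π φ : B →+ A} (hπ : Surjective π) (hφ : Injective φ)
    (hess : ∀ a : A, a ≠ 0 → ∃ n : ℤ, n • a ≠ 0 ∧ n • a ∈ φ.range) : Surjective φ := by
  have hprime : ∀ p : ℕ, p.Prime → ∀ t : A, (∃ n : ℕ, n ≠ 0 ∧ n • t = 0) → p • t ∈ φ.range →
      t ∈ φ.range := by
    rintro p hp t ⟨n, hn, ht⟩ hpt
    rcases hB.primary p hp with hdiv | hart
    · have ⟨b, hb⟩ := hpt
      obtain ⟨c, rfl⟩ := hdiv b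
      have h1 : t - φ c ∈ φ.range := mem_of_essential_of_prime_nsmul_eq_zero hess hp (by
        rw [nsmul_sub, ← hb, map_nsmul, sub_self])
      simpa using φ.range.add_mem h1 ⟨c, rfl⟩
    -- Only the `p`-primary part `u • t` matters, the rest being a multiple of `p • t`. Once `p • u
    -- • t = φ (p • b)` is known, `u • t - φ b` lies in the socle, which essentiality puts in the
    -- image.
    · obtain ⟨u, v, huv, k, hk⟩ := exists_primary_add_nsmul hp hn ht
      have hker := exists_nsmul_eq_zero_of_surjective_of_injective hB.rank_lt hπ hφ
      have hsurj : Surjective ((φ.multiplesMap p).primaryMap p) :=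
        IsArtinian.surjective_of_surjective_of_injective
          ((φ.multiplesMap p).primaryMap p).toIntLinearMap
          ((π.multiplesMap p).primaryMap p).toIntLinearMap
          (AddMonoidHom.primaryMap_injective (AddMonoidHom.multiplesMap_injective hφ p) p)
          (AddMonoidHom.primaryMap_surjective (AddMonoidHom.multiplesMap_surjective hπ p)
            (fun x hx => (hker x (congrArg Subtype.val hx)).imp
              fun n hn => ⟨hn.1, Subtype.ext hn.2⟩) hp)
      obtain ⟨⟨⟨_, b, rfl⟩, _⟩, hb⟩ := hsurj ⟨⟨p • u • t, u • t, rfl⟩, k, Subtype.ext (by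
        change p ^ k • p • u • t = 0
        rw [smul_comm, hk, smul_zero])⟩
      have hb : φ (p • b) = p • u • t := congrArg Subtype.val (congrArg Subtype.val hb)
      have h1 : u • t - φ b ∈ φ.range := mem_of_essential_of_prime_nsmul_eq_zero hess hp (by
        rw [nsmul_sub, ← hb, map_nsmul, sub_self])
      have h2 : u • t ∈ φ.range := by simpa using φ.range.add_mem h1 ⟨b, rfl⟩
      rw [huv, smul_comm p v t]
      exact φ.range.add_mem h2 (φ.range.zsmul_mem hpt v)
  have htors : ∀ n : ℕ, n ≠ 0 → ∀ t : A, n • t = 0 → t ∈ φ.range := by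
    intro n
    induction n using induction_on_primes with
    | zero => exact fun h => (h rfl).elim
    | one => exact fun _ t ht => by rw [one_smul] at ht; exact ht ▸ φ.range.zero_mem
    | prime_mul p n hp ih =>
      refine fun h0 t ht => hprime p hp t ⟨p * n, h0, ht⟩ (ih (right_ne_zero_of_mul h0) _ ?_)
      rw [← mul_smul, mul_comm, ht]
  intro a
  obtain ⟨n, hn, b, hb⟩ := exists_nsmul_mem_range_of_surjective_of_injective hB.rank_lt hπ hφ a
  obtain ⟨c, m, hm, hc⟩ := hB.divisible_mod_torsion n hn b
  have h1 : a - φ c ∈ φ.range := by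
    refine htors (m * n) (mul_ne_zero hm hn) _ ?_
    rw [mul_smul, nsmul_sub, hb, ← map_nsmul, ← map_sub, ← map_nsmul, hc, map_zero]
  simpa using φ.range.add_mem h1 ⟨c, rfl⟩

theorem exists_maximal_disjoint {A : Type*} [AddCommGroup A] (H : AddSubgroup A) :
    ∃ C : AddSubgroup A, Disjoint H C ∧ ∀ D, C < D → ¬ Disjoint H D := by
  obtain ⟨C, hC⟩ := zorn_le₀ {C : AddSubgroup A | Disjoint H C} (by
    intro c hc hchain
    rcases c.eq_empty_or_nonempty with rfl | hne
    · exact ⟨⊥, disjoint_bot_right, fun z hz => hz.elim⟩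
    · refine ⟨sSup c, ?_, fun z hz => le_sSup hz⟩
      change Disjoint H (sSup c)
      rw [AddSubgroup.disjoint_def]
      intro x hx hxs
      obtain ⟨C, hC, hxC⟩ := (AddSubgroup.mem_sSup_of_directedOn hne hchain.directedOn).1 hxs
      exact AddSubgroup.disjoint_def.1 (hc hC) hx hxC)
  exact ⟨C, hC.prop, fun D hCD hD => hC.not_prop_of_gt hCD hD⟩

/-- Every subgroup becomes essential in a suitable quotient into which it embeds. -/
theorem exists_disjoint_essential {A : Type*} [AddCommGroup A] (H : AddSubgroup A) :
    ∃ C : AddSubgroup A, Disjoint H C ∧ ∀ a : A ⧸ C, a ≠ 0 →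
      ∃ n : ℤ, n • a ≠ 0 ∧ n • a ∈ H.map (QuotientAddGroup.mk' C) := by
  obtain ⟨C, hC, hmax⟩ := exists_maximal_disjoint H
  refine ⟨C, hC, fun a' ha' => ?_⟩
  obtain ⟨a, rfl⟩ := QuotientAddGroup.mk'_surjective C a'
  have ha : a ∉ C := fun h => ha' ((QuotientAddGroup.eq_zero_iff a).2 h)
  have hlt : C < C ⊔ AddSubgroup.zmultiples a :=
    lt_of_le_of_ne le_sup_left fun h => ha (h ▸ AddSubgroup.mem_sup_right
      (AddSubgroup.mem_zmultiples a))
  have hnd := hmax _ hlt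
  rw [AddSubgroup.disjoint_def] at hnd
  push Not at hnd
  obtain ⟨x, hxH, hx, hx0⟩ := hnd
  obtain ⟨c, hc, _, ⟨n, rfl⟩, hcn⟩ := AddSubgroup.mem_sup.1 hx
  have h1 : n • QuotientAddGroup.mk' C a = QuotientAddGroup.mk' C x := by
    have hc0 : QuotientAddGroup.mk' C c = 0 := (QuotientAddGroup.eq_zero_iff c).2 hc
    rw [← hcn, map_add, hc0, zero_add, ← map_zsmul]
  refine ⟨n, fun h0 => hx0 ?_, x, hxH, h1.symm⟩
  rw [h1] at h0
  exact AddSubgroup.disjoint_def.1 hC hxH ((QuotientAddGroup.eq_zero_iff x).1 h0)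

/-- Modulo a maximal disjoint `C` the embedding is essential, hence onto `A ⧸ C`; this says that
`φ.range` and `C` span `A`. -/
theorem IsFiniteRankMixed.isDirectSummand_range {A B : Type u} [AddCommGroup A] [AddCommGroup B]
    (hB : IsFiniteRankMixed B) {π φ : B →+ A} (hπ : Surjective π) (hφ : Injective φ) :
    IsDirectSummand φ.range := by
  obtain ⟨C, hC, hess⟩ := exists_disjoint_essential φ.range
  refine ⟨C, hC, ?_⟩
  let q : A →+ A ⧸ C := QuotientAddGroup.mk' C
  have hq : ∀ a, q a = 0 ↔ a ∈ C := fun a => QuotientAddGroup.eq_zero_iff a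
  have hinj : Injective (q.comp φ) := by
    rw [injective_iff_map_eq_zero]
    intro b hb
    have : φ b = 0 := AddSubgroup.disjoint_def.1 hC ⟨b, rfl⟩ ((hq _).1 hb)
    exact hφ (this.trans φ.map_zero.symm)
  have hsurj : Surjective (q.comp φ) := by
    refine hB.surjective_of_essential (π := q.comp π)
      ((QuotientAddGroup.mk'_surjective C).comp hπ) hinj ?_
    rwa [AddMonoidHom.range_comp]
  rw [codisjoint_iff, eq_top_iff]
  rintro a -
  obtain ⟨b, hb⟩ := hsurj (q a)
  have h1 : a - φ b ∈ C := (hq _).1 (by rw [map_sub, ← hb]; exact sub_self _)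
  exact AddSubgroup.mem_sup.2 ⟨φ b, ⟨b, rfl⟩, _, h1, add_sub_cancel _ _⟩

theorem IsFiniteRankMixed.isGeneralizedCoBassian {B : Type u} [AddCommGroup B]
    (hB : IsFiniteRankMixed B) : IsGeneralizedCoBassian B := fun N _ hφ =>
  hB.isDirectSummand_range (QuotientAddGroup.mk'_surjective N) hφ

theorem isFiniteRankMixed_of_surjective {A B : Type u} [AddCommGroup A] [AddCommGroup B]
    (hr : Module.rank ℤ A < Cardinal.aleph0)
    (hd : ∀ n : ℕ, n ≠ 0 → ∀ b : A, ∃ c, ∃ m : ℕ, m ≠ 0 ∧ m • (b - n • c) = 0)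
    (hp : ∀ p : ℕ, p.Prime → (∀ b : A, ∃ c, p • c = b) ∨
      {x : multiplesSubgroup p A | p • x = 0}.Finite)
    {f : A →+ B} (hf : Surjective f) : IsFiniteRankMixed B where
  rank_lt := (LinearMap.rank_le_of_surjective f.toIntLinearMap hf).trans_lt hr
  divisible_mod_torsion n hn b := by
    obtain ⟨a, rfl⟩ := hf b
    obtain ⟨c, m, hm, h⟩ := hd n hn a
    exact ⟨f c, m, hm, by rw [← map_nsmul, ← map_sub, ← map_nsmul, h, map_zero]⟩
  primary p hpp := by
    refine (hp p hpp).imp (fun h b => ?_) fun h => ?_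
    · obtain ⟨a, rfl⟩ := hf b
      obtain ⟨c, rfl⟩ := h a
      exact ⟨f c, (map_nsmul f p c).symm⟩
    · exact isArtinian_primaryComponent_of_surjective hpp
        ((LinearMap.rank_le_of_injective (multiplesSubgroup p A).subtype.toIntLinearMap
          Subtype.val_injective).trans_lt hr) h (AddMonoidHom.multiplesMap_surjective hf p)

/-! ### Finite `p`-rank, divisible groups and sufficiency. -/

theorem hasFinitePRank_iff {p : ℕ} (hp : p.Prime) {A : Type*} [AddCommGroup A] :
    HasFinitePRank p A ↔ {x : A | p • x = 0}.Finite := by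
  have : Fact p.Prime := ⟨hp⟩
  let : Module (ZMod p) (AddSubgroup.torsionBy A (p : ℤ)) := AddSubgroup.torsionBy.zmodModule
  have h1 : HasFinitePRank p A ↔ Finite (AddSubgroup.torsionBy A (p : ℤ)) := by
    unfold HasFinitePRank pRank
    rw [Module.rank_lt_aleph0_iff]
    exact ⟨fun h => Module.finite_of_finite (ZMod p), fun h => inferInstance⟩
  have h2 : (AddSubgroup.torsionBy A (p : ℤ) : Set A) = {x : A | p • x = 0} := by
    ext x
    simp [AddSubgroup.torsionBy]
  rw [h1, ← h2]
  rfl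

theorem isDivisibleGroup_iff {A : Type*} [AddCommGroup A] :
    IsDivisibleGroup A ↔ ∀ n : ℕ, n ≠ 0 → ∀ a : A, ∃ b, n • b = a := by
  constructor
  · rintro ⟨h⟩ n hn a
    exact ⟨DivisibleBy.div a (n : ℤ), by
      rw [← natCast_zsmul]; exact DivisibleBy.div_cancel a (Nat.cast_ne_zero.2 hn)⟩
  · intro h
    refine ⟨divisibleByOfSMulRightSurj A ℤ fun {n} hn a => ?_⟩
    obtain ⟨b, hb⟩ := h n.natAbs (Int.natAbs_ne_zero.2 hn) a
    rcases Int.natAbs_eq n with h | h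
    · exact ⟨b, by change n • b = a; rw [h, natCast_zsmul, hb]⟩
    · exact ⟨-b, by change n • -b = a; rw [h, neg_smul_neg, natCast_zsmul, hb]⟩

theorem isDivisibleGroup_of_prime {A : Type*} [AddCommGroup A]
    (h : ∀ p : ℕ, p.Prime → ∀ a : A, ∃ b, p • b = a) : IsDivisibleGroup A := by
  rw [isDivisibleGroup_iff]
  intro n
  induction n using induction_on_primes with
  | zero => exact fun h => (h rfl).elim
  | one => exact fun _ a => ⟨a, one_smul _ _⟩
  | prime_mul p n hp ih =>
    intro h0 a
    obtain ⟨b, rfl⟩ := h p hp a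
    obtain ⟨c, rfl⟩ := ih (right_ne_zero_of_mul h0) b
    exact ⟨c, mul_smul _ _ _⟩

theorem IsDivisibleGroup.of_surjective {A B : Type*} [AddCommGroup A] [AddCommGroup B]
    (hA : IsDivisibleGroup A) {f : A →+ B} (hf : Surjective f) : IsDivisibleGroup B := by
  rw [isDivisibleGroup_iff] at hA ⊢
  intro n hn b
  obtain ⟨a, rfl⟩ := hf b
  obtain ⟨c, rfl⟩ := hA n hn a
  exact ⟨f c, (map_nsmul f n c).symm⟩

theorem IsDivisibleGroup.extend {D X Y : Type*} [AddCommGroup D] [AddCommGroup X] [AddCommGroup Y]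
    (hD : IsDivisibleGroup D) (i : X →+ Y) (hi : Injective i) (f : X →+ D) :
    ∃ g : Y →+ D, ∀ x, g (i x) = f x := by
  obtain ⟨_⟩ := hD
  obtain ⟨g, hg⟩ := (Module.Baer.of_divisible D).extension_property_addMonoidHom i hi f
  exact ⟨g, fun x => DFunLike.congr_fun hg x⟩

theorem IsDivisibleGroup.exists_retraction {G : Type*} [AddCommGroup G] {D : AddSubgroup G}
    (hD : IsDivisibleGroup D) : ∃ r : G →+ D, ∀ x : D, r x = x :=
  hD.extend D.subtype Subtype.val_injective (AddMonoidHom.id D)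

theorem IsDivisibleGroup.isDirectSummand {G : Type*} [AddCommGroup G] {D : AddSubgroup G}
    (hD : IsDivisibleGroup D) : IsDirectSummand D := by
  obtain ⟨r, hr⟩ := hD.exists_retraction
  refine ⟨r.ker, AddSubgroup.disjoint_def.2 fun {x} hx hx' => ?_, ?_⟩
  · have h1 := hr ⟨x, hx⟩
    rw [show r x = 0 from hx'] at h1
    exact (congrArg Subtype.val h1).symm
  · rw [codisjoint_iff, eq_top_iff]
    rintro a -
    exact AddSubgroup.mem_sup.2 ⟨r a, (r a).2, a - r a, by
      rw [AddMonoidHom.mem_ker, map_sub, hr, sub_self], add_sub_cancel _ _⟩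

theorem IsDivisibleGroup.isSuperGeneralizedCoBassian {G : Type*} [AddCommGroup G]
    (hG : IsDivisibleGroup G) : IsSuperGeneralizedCoBassian G := fun K _ φ _ =>
  ((hG.of_surjective (QuotientAddGroup.mk'_surjective K)).of_surjective
    φ.rangeRestrict_surjective).isDirectSummand

section Torsion

variable {G : Type u} [AddCommGroup G]

theorem mk_torsion_eq_zero_iff (x : G) :
    (x : G ⧸ AddCommGroup.torsion G) = 0 ↔ ∃ n : ℕ, n ≠ 0 ∧ n • x = 0 := by
  rw [QuotientAddGroup.eq_zero_iff, AddCommGroup.mem_torsion, isOfFinAddOrder_iff_nsmul_eq_zero]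
  simp [Nat.pos_iff_ne_zero]

theorem exists_sub_nsmul_torsion (hd : IsDivisibleGroup (G ⧸ AddCommGroup.torsion G)) (n : ℕ)
    (hn : n ≠ 0) (b : G) : ∃ c, ∃ m : ℕ, m ≠ 0 ∧ m • (b - n • c) = 0 := by
  obtain ⟨c', hc⟩ := isDivisibleGroup_iff.1 hd n hn (b : G ⧸ AddCommGroup.torsion G)
  obtain ⟨c, rfl⟩ := QuotientAddGroup.mk_surjective c'
  exact ⟨c, (mk_torsion_eq_zero_iff _).1 (by
    rw [QuotientAddGroup.mk_sub, ← hc, QuotientAddGroup.mk_nsmul, sub_self])⟩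

/-- Modulo its multiples of `p`, a group which is divisible modulo torsion is generated by its
`p`-primary component. -/
theorem exists_sub_nsmul_primary (hd : IsDivisibleGroup (G ⧸ AddCommGroup.torsion G)) {p : ℕ}
    (hp : p.Prime) (b : G) : ∃ c, b - p • c ∈ AddCommGroup.primaryComponent G p := by
  obtain ⟨c, m, hm, h⟩ := exists_sub_nsmul_torsion hd p hp.ne_zero b
  obtain ⟨u, v, huv, hmem⟩ := exists_primary_add_nsmul hp hm h
  refine ⟨c + v • (b - p • c), ?_⟩
  have : b - p • (c + v • (b - p • c)) = u • (b - p • c) := by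
    rw [nsmul_add, ← sub_sub]
    nth_rw 1 [huv]
    abel
  rwa [this]

theorem rank_lt_aleph0_of_hasFiniteRank (h : HasFiniteRank (G ⧸ AddCommGroup.torsion G)) :
    Module.rank ℤ G < Cardinal.aleph0 := by
  let f : G →ₗ[ℤ] G ⧸ AddCommGroup.torsion G :=
    (QuotientAddGroup.mk' (AddCommGroup.torsion G)).toIntLinearMap
  have h1 := LinearMap.rank_range_add_rank_ker f
  have h2 : Module.rank ℤ (LinearMap.ker f) = 0 := by
    refine rank_eq_zero_iff.2 fun x => ?_
    obtain ⟨n, hn, h⟩ := (mk_torsion_eq_zero_iff (x : G)).1 x.2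
    exact ⟨n, Nat.cast_ne_zero.2 hn, Subtype.ext (by rw [natCast_zsmul]; exact h)⟩
  rw [← h1, h2, add_zero]
  exact (Submodule.rank_le _).trans_lt h

theorem isSuperGeneralizedCoBassian_of_finite_rank
    (hd : IsDivisibleGroup (G ⧸ AddCommGroup.torsion G))
    (hr : HasFiniteRank (G ⧸ AddCommGroup.torsion G))
    (hp : ∀ p : ℕ, p.Prime → IsDivisibleGroup (AddCommGroup.primaryComponent G p) ∨
      HasFinitePRank p (multiplesSubgroup p (AddCommGroup.primaryComponent G p))) :
    IsSuperGeneralizedCoBassian G := by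
  intro K
  refine (isFiniteRankMixed_of_surjective (rank_lt_aleph0_of_hasFiniteRank hr)
    (exists_sub_nsmul_torsion hd) (fun p hpp => (hp p hpp).imp (fun h b => ?_) fun h => ?_)
    (QuotientAddGroup.mk'_surjective K)).isGeneralizedCoBassian
  · obtain ⟨c, hc⟩ := exists_sub_nsmul_primary hd hpp b
    obtain ⟨t, ht⟩ := isDivisibleGroup_iff.1 h p hpp.ne_zero ⟨_, hc⟩
    have ht : p • (t : G) = b - p • c := congrArg Subtype.val ht
    exact ⟨t + c, by rw [nsmul_add, ht, sub_add_cancel]⟩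
  · rw [hasFinitePRank_iff hpp] at h
    refine Set.Finite.of_finite_image (f := Subtype.val) ?_ Subtype.val_injective.injOn
    refine (h.image fun x : multiplesSubgroup p (AddCommGroup.primaryComponent G p) =>
      ((x : AddCommGroup.primaryComponent G p) : G)).subset ?_
    rintro _ ⟨⟨_, b, rfl⟩, hb, rfl⟩
    have hb : p • p • b = 0 := congrArg Subtype.val hb
    exact ⟨⟨_, ⟨b, 2, by rw [pow_two, mul_smul, hb]⟩, rfl⟩,
      Subtype.ext (Subtype.ext hb), rfl⟩

end Torsion

/-! ### Necessity: purity of images and maps to `ℤ/p`. -/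

theorem IsSuperGeneralizedCoBassian.isDirectSummand_range {G B A : Type*} [AddCommGroup G]
    [AddCommGroup B] [AddCommGroup A] (hG : IsSuperGeneralizedCoBassian G) {f : G →+ B}
    (hf : Surjective f) {g : B →+ A} (hg : Surjective g) {φ : B →+ A} (hφ : Injective φ) :
    IsDirectSummand φ.range := by
  let e : G ⧸ f.ker ≃+ B := QuotientAddGroup.quotientKerEquivOfSurjective f hf
  let k : G ⧸ f.ker →+ A := g.comp e.toAddMonoidHom
  let e' : (G ⧸ f.ker) ⧸ k.ker ≃+ A :=
    QuotientAddGroup.quotientKerEquivOfSurjective k (hg.comp e.surjective)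
  obtain ⟨C, hC⟩ := hG f.ker k.ker
    ((e'.symm.toAddMonoidHom.comp φ).comp e.toAddMonoidHom)
    (e'.symm.injective.comp (hφ.comp e.injective))
  have h1 : e'.mapAddSubgroup ((e'.symm.toAddMonoidHom.comp φ).comp e.toAddMonoidHom).range =
      φ.range := by
    ext a
    constructor
    · rintro ⟨_, ⟨x, rfl⟩, rfl⟩
      exact ⟨e x, by simp⟩
    · rintro ⟨b, rfl⟩
      exact ⟨e'.symm (φ b), ⟨e.symm b, by simp⟩, by simp⟩
  exact ⟨e'.mapAddSubgroup C, h1 ▸ e'.mapAddSubgroup.isCompl hC⟩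

/-- Purity of direct summands, the only consequence of being a summand that necessity uses. -/
theorem IsDirectSummand.exists_nsmul_eq {A : Type*} [AddCommGroup A] {H : AddSubgroup A}
    (hH : IsDirectSummand H) {n : ℕ} {y : A} (hy : n • y ∈ H) : ∃ h ∈ H, n • h = n • y := by
  obtain ⟨C, hC⟩ := hH
  obtain ⟨h, hh, c, hc, rfl⟩ := AddSubgroup.mem_sup.1
    (show y ∈ H ⊔ C from hC.sup_eq_top ▸ AddSubgroup.mem_top y)
  rw [nsmul_add] at hy ⊢
  have h1 : n • c = 0 := AddSubgroup.disjoint_def.1 hC.disjoint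
    ((H.add_mem_cancel_left (H.nsmul_mem hh n)).1 hy) (C.nsmul_mem hc n)
  exact ⟨h, hh, by rw [h1, add_zero]⟩

theorem IsSuperGeneralizedCoBassian.false_of_divisible_image {G M A : Type*} [AddCommGroup G]
    [AddCommGroup M] [AddCommGroup A] (hG : IsSuperGeneralizedCoBassian G) {p : ℕ} (hp : p.Prime)
    {f : G →+ M × ZMod p} (hf : Surjective f) {g : M × ZMod p →+ A} (hg : Surjective g)
    {φ : M × ZMod p →+ A} (hφ : Injective φ) {y : A} (hy : p • y = φ (0, 1)) : False := by
  obtain ⟨_, ⟨⟨m, c⟩, rfl⟩, hmc⟩ :=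
    (hG.isDirectSummand_range hf hg hφ).exists_nsmul_eq (n := p) (y := y) (hy ▸ ⟨_, rfl⟩)
  rw [hy, ← map_nsmul] at hmc
  have h1 : p • c = 1 := congrArg Prod.snd (hφ hmc)
  have : Fact p.Prime := ⟨hp⟩
  simp at h1

theorem IsSuperGeneralizedCoBassian.isDivisibleGroup_quotient_torsion {G : Type u}
    [AddCommGroup G] (hG : IsSuperGeneralizedCoBassian G) :
    IsDivisibleGroup (G ⧸ AddCommGroup.torsion G) := by
  rw [isDivisibleGroup_iff]
  intro n hn x
  have hinj : Injective (nsmulAddMonoidHom n : G ⧸ AddCommGroup.torsion G →+ _) :=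
    nsmul_right_injective hn
  obtain ⟨_, ⟨h, rfl⟩, hh⟩ := (hG.isDirectSummand_range (QuotientAddGroup.mk'_surjective _)
    (g := AddMonoidHom.id _) surjective_id hinj).exists_nsmul_eq (n := n) (y := x) ⟨x, rfl⟩
  exact ⟨h, hinj hh⟩

theorem exists_zmod_linear_ne_zero {p : ℕ} [Fact p.Prime] {V : Type*} [AddCommGroup V]
    [Module (ZMod p) V] {v : V} (hv : v ≠ 0) : ∃ ψ : V →+ ZMod p, ψ v ≠ 0 := by
  obtain ⟨ψ, hψ⟩ := Module.Projective.exists_dual_ne_zero (ZMod p) hv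
  exact ⟨ψ.toAddMonoidHom, hψ⟩

theorem exists_zmod_hom_ne_zero {G : Type*} [AddCommGroup G] {p : ℕ} (hp : p.Prime) {x : G}
    (hx : ∀ y, p • y ≠ x) : ∃ χ : G →+ ZMod p, χ x ≠ 0 := by
  have : Fact p.Prime := ⟨hp⟩
  let K := multiplesSubgroup p G
  let : Module (ZMod p) (G ⧸ K) := QuotientAddGroup.zmodModule fun x => ⟨x, rfl⟩
  have h1 : (x : G ⧸ K) ≠ 0 := fun h => by
    obtain ⟨y, hy⟩ := (QuotientAddGroup.eq_zero_iff x).1 h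
    exact hx y hy
  obtain ⟨ψ, hψ⟩ := exists_zmod_linear_ne_zero (p := p) h1
  exact ⟨ψ.comp (QuotientAddGroup.mk' K), hψ⟩

/-- Divisibility of `D` allows `x` to be corrected by some `p • y` so as to lie in `ker f`; `χ` does
not see the correction, so `χ` is already onto on `ker f`. -/
theorem surjective_prod_zmod {G D : Type*} [AddCommGroup G] [AddCommGroup D] {p : ℕ}
    (hp : p.Prime) (hD : IsDivisibleGroup D) {f : G →+ D} (hf : Surjective f) {χ : G →+ ZMod p}
    {x : G} (hx : χ x ≠ 0) : Surjective (f.prod χ) := by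
  have : Fact p.Prime := ⟨hp⟩
  obtain ⟨d, hd⟩ := isDivisibleGroup_iff.1 hD p hp.ne_zero (f x)
  obtain ⟨y, rfl⟩ := hf d
  have hk : f (x - p • y) = 0 := by rw [map_sub, map_nsmul, hd, sub_self]
  have hχ : χ (x - p • y) ≠ 0 := by simpa using hx
  rintro ⟨d, c⟩
  obtain ⟨z, rfl⟩ := hf d
  refine ⟨z + ((c - χ z) / χ (x - p • y)).val • (x - p • y), Prod.ext ?_ ?_⟩
  · rw [AddMonoidHom.prod_apply, map_add, map_nsmul, hk, smul_zero, add_zero]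
  · change χ _ = c
    rw [map_add, map_nsmul, nsmul_eq_mul, ZMod.natCast_zmod_val,
      div_mul_cancel₀ _ hχ, add_sub_cancel]

/-! ### Necessity: socles of divisible images and the torsion-free rank. -/

theorem nonempty_prod_zmod_equiv {p : ℕ} [Fact p.Prime] {V : Type*} [AddCommGroup V]
    [Module (ZMod p) V] [Infinite V] : Nonempty ((V × ZMod p) ≃ₗ[ZMod p] V) := by
  have h1 : Cardinal.aleph0 ≤ Module.rank (ZMod p) V := by
    by_contra! h
    rw [Module.rank_lt_aleph0_iff] at h
    have : Finite V := Module.finite_of_finite (ZMod p)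
    exact not_finite V
  apply nonempty_linearEquiv_of_rank_eq
  simp [rank_prod, Cardinal.add_one_eq h1]

theorem isDivisibleGroup_of_primary {D : Type*} [AddCommGroup D] {p : ℕ} (hp : p.Prime)
    (h : ∀ d : D, ∃ k : ℕ, p ^ k • d = 0) (hd : ∀ d : D, ∃ e, p • e = d) :
    IsDivisibleGroup D := by
  refine isDivisibleGroup_of_prime fun q hq d => ?_
  by_cases hqp : q = p
  · exact hqp ▸ hd d
  obtain ⟨k, hk⟩ := h d
  obtain ⟨u, v, huv⟩ : IsCoprime (q : ℤ) ((p ^ k : ℕ) : ℤ) :=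
    Nat.isCoprime_iff_coprime.2 (((Nat.coprime_primes hq hp).2 hqp).pow_right k)
  refine ⟨u • d, ?_⟩
  nth_rw 2 [← one_smul ℤ d]
  rw [← huv, add_smul, mul_smul v, natCast_zsmul, hk, smul_zero, add_zero, mul_comm, mul_smul,
    natCast_zsmul]

theorem IsSuperGeneralizedCoBassian.finite_socle_of_primary {G D : Type*} [AddCommGroup G]
    [AddCommGroup D] (hG : IsSuperGeneralizedCoBassian G) {p : ℕ} (hp : p.Prime) {x : G}
    (hx : ∀ y, p • y ≠ x) (hD : IsDivisibleGroup D) (hDp : ∀ d : D, ∃ k : ℕ, p ^ k • d = 0)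
    {f : G →+ D} (hf : Surjective f) : {d : D | p • d = 0}.Finite := by
  have : Fact p.Prime := ⟨hp⟩
  let V := (nsmulAddMonoidHom p : D →+ D).ker
  have hV : ∀ d, d ∈ V ↔ p • d = 0 := fun d => Iff.rfl
  let : Module (ZMod p) V := AddCommGroup.zmodModule fun v => Subtype.ext v.2
  by_contra hinf
  have : Infinite V := Set.infinite_coe_iff.2 hinf
  obtain ⟨e⟩ := nonempty_prod_zmod_equiv (p := p) (V := V)
  let i : V × ZMod p →+ D × ZMod p := V.subtype.prodMap (AddMonoidHom.id _)
  have hi : Injective i := Subtype.val_injective.prodMap injective_id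
  -- An infinite socle `V` absorbs a copy of `ℤ/p`. The isomorphism `V × ℤ/p ≃ V` extends to `D ×
  -- ℤ/p → D`, and the extension is injective because it is so on the socle of a `p`-group.
  obtain ⟨φ, hφ⟩ := hD.extend i hi (V.subtype.comp e.toAddMonoidHom)
  have hφ' : ∀ k : ℕ, ∀ z : D × ZMod p, p ^ k • z = 0 → φ z = 0 → z = 0 := by
    intro k
    induction k with
    | zero => exact fun z hz _ => by simpa using hz
    | succ k ih =>
      intro z hz hφz
      have h1 : p • z = 0 := ih (p • z) (by rwa [← mul_smul, ← pow_succ]) (by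
        rw [map_nsmul, hφz, smul_zero])
      let w : V × ZMod p := (⟨z.1, congrArg Prod.fst h1⟩, z.2)
      have h2 : i w = z := rfl
      rw [← h2, hφ] at hφz
      have h3 : e.toAddMonoidHom w = 0 := Subtype.ext hφz
      rw [← h2, e.toAddEquiv.map_eq_zero_iff.1 h3, map_zero]
  have hinj : Injective φ := by
    rw [injective_iff_map_eq_zero]
    rintro ⟨d, c⟩ hz
    obtain ⟨k, hk⟩ := hDp d
    refine hφ' (k + 1) _ (Prod.ext ?_ ?_) hz
    · change p ^ (k + 1) • d = 0
      rw [pow_succ', mul_smul, hk, smul_zero]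
    · change p ^ (k + 1) • c = 0
      simp [pow_succ]
  obtain ⟨χ, hχ⟩ := exists_zmod_hom_ne_zero hp hx
  obtain ⟨y, hy⟩ := isDivisibleGroup_iff.1 hD p hp.ne_zero (φ (0, 1))
  exact hG.false_of_divisible_image hp (surjective_prod_zmod hp hD hf hχ)
    (g := AddMonoidHom.fst D (ZMod p)) Prod.fst_surjective hinj hy

/-- A super generalized co-Bassian group which is not `p`-divisible has no divisible homomorphic
image of infinite `p`-rank. -/
theorem IsSuperGeneralizedCoBassian.finite_socle {G D : Type*} [AddCommGroup G]
    [AddCommGroup D] (hG : IsSuperGeneralizedCoBassian G) {p : ℕ} (hp : p.Prime) {x : G}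
    (hx : ∀ y, p • y ≠ x) (hD : IsDivisibleGroup D) {f : G →+ D} (hf : Surjective f) :
    {d : D | p • d = 0}.Finite := by
  have hP : ∀ d : AddCommGroup.primaryComponent D p, ∃ k : ℕ, p ^ k • d = 0 := fun d =>
    d.2.imp fun k hk => Subtype.ext hk
  have hdiv : IsDivisibleGroup (AddCommGroup.primaryComponent D p) := by
    refine isDivisibleGroup_of_primary hp hP ?_
    rintro ⟨d, k, hk⟩
    obtain ⟨e, rfl⟩ := isDivisibleGroup_iff.1 hD p hp.ne_zero d
    exact ⟨⟨e, k + 1, by rwa [pow_succ, mul_smul]⟩, rfl⟩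
  obtain ⟨r, hr⟩ := hdiv.exists_retraction
  have h1 := hG.finite_socle_of_primary hp hx hdiv hP (f := r.comp f)
    ((show Surjective r from fun d => ⟨d, hr d⟩).comp hf)
  refine (h1.image Subtype.val).subset fun d hd => ?_
  exact ⟨⟨d, 1, by rwa [pow_one]⟩, Subtype.ext hd, rfl⟩

theorem infinite_socle_quotient {X : Type*} [AddCommGroup X]
    (h : Cardinal.aleph0 ≤ Module.rank ℤ X) {p : ℕ} (hp : p.Prime) :
    ∃ K : AddSubgroup X, {x : X ⧸ K | p • x = 0}.Infinite := by
  obtain ⟨s, hs, hli⟩ := exists_set_linearIndependent ℤ X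
  have hinf : Infinite s := Cardinal.aleph0_le_mk_iff.1 (hs ▸ h)
  -- For `F` free on `s`, the quotient by `pF` has `F/pF` in its socle, where the elements of `s`
  -- remain distinct.
  let K : AddSubgroup X := (AddSubgroup.closure s).map (nsmulAddMonoidHom p)
  refine ⟨K, Set.infinite_of_injective_forall_mem (f := fun x : s => ((x : X) : X ⧸ K)) ?_ ?_⟩
  · intro x y hxy
    by_contra hne
    obtain ⟨f, hf, hfx⟩ := QuotientAddGroup.eq.1 hxy
    have hfx : p • f = -(x : X) + y := hfx
    have hf : f ∈ Submodule.span ℤ (Set.range ((↑) : s → X)) := by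
      rw [Subtype.range_coe, ← Submodule.mem_toAddSubgroup, Submodule.span_int_eq_addSubgroupClosure]
      exact hf
    obtain ⟨l, rfl⟩ := (Finsupp.mem_span_range_iff_exists_finsupp).1 hf
    have h0 := linearIndependent_iff.1 hli (p • l + Finsupp.single x 1 - Finsupp.single y 1) (by
      rw [map_sub, map_add, map_nsmul, Finsupp.linearCombination_single,
        Finsupp.linearCombination_single, one_smul, one_smul, Finsupp.linearCombination_apply, hfx]
      abel)
    have h1 := DFunLike.congr_fun h0 x
    rw [Finsupp.sub_apply, Finsupp.add_apply, Finsupp.smul_apply, Finsupp.single_eq_same,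
      Finsupp.single_eq_of_ne hne, nsmul_eq_mul, Finsupp.zero_apply] at h1
    have h2 : (p : ℤ) ∣ 1 := ⟨-l x, by linarith⟩
    exact (Nat.prime_iff_prime_int.1 hp).not_isUnit (isUnit_of_dvd_one h2)
  · exact fun x => (QuotientAddGroup.eq_zero_iff (p • (x : X))).2
      ⟨x, AddSubgroup.subset_closure x.2, rfl⟩

theorem IsSuperGeneralizedCoBassian.hasFiniteRank_quotient_torsion {G : Type u}
    [AddCommGroup G] (hG : IsSuperGeneralizedCoBassian G) (hdiv : ¬ IsDivisibleGroup G) :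
    HasFiniteRank (G ⧸ AddCommGroup.torsion G) := by
  obtain ⟨p, hp, x, hx⟩ : ∃ p : ℕ, p.Prime ∧ ∃ x : G, ∀ y, p • y ≠ x := by
    by_contra! h
    exact hdiv (isDivisibleGroup_of_prime h)
  by_contra hr
  obtain ⟨K, hK⟩ := infinite_socle_quotient (not_lt.1 hr) hp
  have hs := QuotientAddGroup.mk'_surjective K
  exact hK (hG.finite_socle hp hx
    (hG.isDivisibleGroup_quotient_torsion.of_surjective hs)
    (f := (QuotientAddGroup.mk' K).comp (QuotientAddGroup.mk' _))
    (hs.comp (QuotientAddGroup.mk'_surjective _)))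

/-! ### Necessity: images that are free over `ℤ/p²`. -/

theorem zmod_sq_exists_eq_mul {p : ℕ} (hp : p ≠ 0) {a : ZMod (p ^ 2)}
    (h : ZMod.castHom (dvd_pow_self p two_ne_zero) (ZMod p) a = 0) : ∃ c, a = p • c := by
  have : NeZero (p ^ 2) := ⟨pow_ne_zero 2 hp⟩
  rw [← ZMod.natCast_zmod_val a, map_natCast, ZMod.natCast_eq_zero_iff] at h
  obtain ⟨k, hk⟩ := h
  exact ⟨k, by rw [← ZMod.natCast_zmod_val a, hk]; simp⟩

theorem finsupp_exists_eq_nsmul {p : ℕ} (hp : p ≠ 0) {I : Type*} {m : I →₀ ZMod (p ^ 2)}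
    (h : ∀ i, ZMod.castHom (dvd_pow_self p two_ne_zero) (ZMod p) (m i) = 0) :
    ∃ m', m = p • m' := by
  choose c hc using fun i => zmod_sq_exists_eq_mul hp (h i)
  refine ⟨Finsupp.onFinset m.support (fun i => if m i = 0 then 0 else c i) fun i hi => ?_, ?_⟩
  · rw [Finsupp.mem_support_iff]
    exact fun h0 => hi (if_pos h0)
  · ext i
    rw [Finsupp.smul_apply, Finsupp.onFinset_apply]
    split_ifs with h0
    · rw [h0, smul_zero]
    · exact hc i

/-- A super generalized co-Bassian group has no free `ℤ / p ^ 2`-module of infinite rank as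
homomorphic image. -/
theorem IsSuperGeneralizedCoBassian.not_surjective_finsupp {G : Type*} [AddCommGroup G]
    (hG : IsSuperGeneralizedCoBassian G) {p : ℕ} (hp : p.Prime) {I : Type*} [Infinite I]
    (f : G →+ (I →₀ ZMod (p ^ 2))) : ¬ Surjective f := by
  intro hf
  have : Fact p.Prime := ⟨hp⟩
  obtain ⟨e⟩ : Nonempty (Option I ≃ I) := by
    rw [← Cardinal.eq, Cardinal.mk_option]
    exact Cardinal.add_one_eq (Cardinal.aleph0_le_mk I)
  let j : I → I := fun i => e (some i)
  have hj : Injective j := e.injective.comp (Option.some_injective I)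
  let red : ZMod (p ^ 2) →+ ZMod p := ZMod.castHom (dvd_pow_self p two_ne_zero) (ZMod p)
  -- Since `I` absorbs one extra index, the coordinate `e none` can be split off and reduced modulo
  -- `p`. Conversely, `φ` below puts `ℤ/p` back there as `p ℤ/p²`, whose generator is `p` times a
  -- basis vector.
  let α : (I →₀ ZMod (p ^ 2)) →+ (I →₀ ZMod (p ^ 2)) × ZMod p :=
    (Finsupp.comapDomain.addMonoidHom hj).prod (red.comp (Finsupp.applyAddHom (e none)))
  have hα : Surjective α := by
    rintro ⟨m, c⟩
    refine ⟨m.mapDomain j + Finsupp.single (e none) (c.val : ZMod (p ^ 2)), Prod.ext ?_ ?_⟩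
    · ext i
      have : e none ≠ j i := fun h => by simpa using e.injective h
      simp [α, Finsupp.comapDomain_apply, Finsupp.mapDomain_apply hj, this]
    · have : e none ∉ Set.range j := by
        rintro ⟨i, hi⟩
        simpa using e.injective hi
      simp [α, red, Finsupp.mapDomain_of_notMem_range m _ this]
  have hsq : ((p : ZMod (p ^ 2)) * p) = 0 := by
    rw [← pow_two, ← Nat.cast_pow, ZMod.natCast_self]
  let γ : {f : ℤ →+ ZMod (p ^ 2) // f p = 0} :=
    ⟨(AddMonoidHom.mulLeft (p : ZMod (p ^ 2))).comp (Int.castAddHom _), by simpa using hsq⟩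
  let β : ZMod p →+ ZMod (p ^ 2) := ZMod.lift p γ
  have hβ : ∀ n : ℕ, β n = ((p * n : ℕ) : ZMod (p ^ 2)) := fun n => by
    simpa [γ] using ZMod.lift_coe p γ n
  have hβ_inj : ∀ c, β c = 0 → c = 0 := by
    intro c hc
    rw [← ZMod.natCast_zmod_val c, hβ, ZMod.natCast_eq_zero_iff, pow_two] at hc
    rw [← ZMod.natCast_zmod_val c, ZMod.natCast_eq_zero_iff]
    exact Nat.dvd_of_mul_dvd_mul_left hp.pos hc
  let φ : (I →₀ ZMod (p ^ 2)) × ZMod p →+ (I →₀ ZMod (p ^ 2)) :=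
    (Finsupp.mapDomain.addMonoidHom j).coprod ((Finsupp.singleAddHom (e none)).comp β)
  have hφ : ∀ z, φ z = z.1.mapDomain j + Finsupp.single (e none) (β z.2) := fun z => rfl
  have hφ_inj : Injective φ := by
    rw [injective_iff_map_eq_zero]
    rintro ⟨m, c⟩ h
    rw [hφ] at h
    refine Prod.ext ?_ (hβ_inj c ?_)
    · ext i
      have hne : j i ≠ e none := fun h => by simpa using e.injective h
      simpa [Finsupp.mapDomain_apply hj, Finsupp.single_eq_of_ne hne] using
        DFunLike.congr_fun h (j i)
    · have hne : e none ∉ Set.range j := by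
        rintro ⟨i, hi⟩
        simpa using e.injective hi
      simpa [Finsupp.mapDomain_of_notMem_range m _ hne] using DFunLike.congr_fun h (e none)
  refine hG.false_of_divisible_image hp (hα.comp hf) (f := α.comp f)
    (g := AddMonoidHom.fst _ _) Prod.fst_surjective hφ_inj (y := Finsupp.single (e none) 1) ?_
  rw [hφ]
  have h1 : β 1 = p := by simpa using hβ 1
  simp [h1]

/-- A group of exponent dividing `p ^ 2` with infinitely many multiples of `p` has a free
`ℤ / p ^ 2`-module of infinite rank as homomorphic image. -/
theorem exists_quotient_equiv_finsupp {B : Type u} [AddCommGroup B] {p : ℕ} (hp : p.Prime)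
    [Fact p.Prime] [Module (ZMod (p ^ 2)) B] (V : AddSubgroup B) (hVB : V = multiplesSubgroup p B)
    [Module (ZMod p) V] [Infinite V] :
    ∃ (C : AddSubgroup B) (I : Type u), Infinite I ∧ Nonempty (B ⧸ C ≃+ (I →₀ ZMod (p ^ 2))) := by
  subst hVB
  let V := multiplesSubgroup p B
  let I := Module.Basis.ofVectorSpaceIndex (ZMod p) V
  let v : Module.Basis I (ZMod p) V := Module.Basis.ofVectorSpace (ZMod p) V
  have hI : Infinite I := by
    by_contra hI
    rw [not_infinite_iff_finite] at hI
    have : Module.Finite (ZMod p) V := Module.Finite.of_basis v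
    have := Module.finite_of_finite (ZMod p) (M := V)
    exact not_finite V
  -- The lifts `b i` of a basis of `pB` under multiplication by `p` are independent over `ℤ/p²`; `s`
  -- is the resulting embedding.
  choose b hb using fun i => (v i).2
  have hb : ∀ i, p • b i = v i := hb
  let red : ZMod (p ^ 2) →+* ZMod p := ZMod.castHom (dvd_pow_self p two_ne_zero) (ZMod p)
  let M := I →₀ ZMod (p ^ 2)
  let s : M →ₗ[ZMod (p ^ 2)] B := Finsupp.linearCombination _ b
  have hps : ∀ m : M, p • s m =
      (Finsupp.linearCombination (ZMod p) v (m.mapRange red (map_zero red)) : V) := by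
    intro m
    induction m using Finsupp.induction_linear with
    | zero => simp
    | add m n hm hn =>
      rw [map_add, nsmul_add, hm, hn, Finsupp.mapRange_add (map_add red), map_add]; rfl
    | single i r =>
      have : NeZero (p ^ 2) := ⟨pow_ne_zero 2 hp.ne_zero⟩
      rw [Finsupp.mapRange_single, Finsupp.linearCombination_single, ← ZMod.natCast_zmod_val r,
        map_natCast, Nat.cast_smul_eq_nsmul]
      simp only [Finsupp.linearCombination_single, Nat.cast_smul_eq_nsmul]
      rw [smul_comm, hb]; rfl
  have hp0 : ∀ m, p • s m = 0 → ∃ m', m = p • m' := by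
    intro m hm
    rw [hps] at hm
    have h1 : m.mapRange red (map_zero red) = 0 :=
      linearIndependent_iff.1 v.linearIndependent _ (Subtype.ext hm)
    exact finsupp_exists_eq_nsmul hp.ne_zero fun i => DFunLike.congr_fun h1 i
  have hs : ∀ m, s m = 0 → m = 0 := by
    intro m hm
    obtain ⟨m', rfl⟩ := hp0 m (by rw [hm, smul_zero])
    obtain ⟨m'', rfl⟩ := hp0 m' (by rwa [← map_nsmul])
    ext i
    have : ((p ^ 2 : ℕ) : ZMod (p ^ 2)) = 0 := ZMod.natCast_self _
    rw [← mul_smul, ← pow_two, Finsupp.smul_apply, nsmul_eq_mul, this, zero_mul,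
      Finsupp.zero_apply]
  have hV : ∀ x ∈ V, ∃ m, s (p • m) = x := by
    intro x hx
    let l := v.repr ⟨x, hx⟩
    refine ⟨l.mapRange (fun c => (c.val : ZMod (p ^ 2))) (by simp), ?_⟩
    have h1 : (l.mapRange (fun c => (c.val : ZMod (p ^ 2))) (by simp)).mapRange red (map_zero red)
        = l := by
      ext i
      simp [red]
    rw [map_nsmul, hps, h1]
    exact congrArg Subtype.val (v.linearCombination_repr ⟨x, hx⟩)
  -- Modulo a maximal `C` disjoint from `pB`, the socle lies in the image of `pB`, hence in that of
  -- `s`. As `pB = s(pM)`, every element differs from one in the image of `s` by a socle element.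
  obtain ⟨C, hC, hess⟩ := exists_disjoint_essential V
  let q : B →+ B ⧸ C := QuotientAddGroup.mk' C
  have hq : ∀ b, q b = 0 ↔ b ∈ C := fun b => QuotientAddGroup.eq_zero_iff b
  let σ : M →+ B ⧸ C := q.comp s.toAddMonoidHom
  have hσ : Bijective σ := by
    constructor
    · rw [injective_iff_map_eq_zero]
      intro m hm
      have hm : s m ∈ C := (hq _).1 hm
      have h1 : p • s m = 0 := AddSubgroup.disjoint_def.1 hC ⟨s m, rfl⟩ (C.nsmul_mem hm p)
      obtain ⟨m', rfl⟩ := hp0 m h1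
      refine hs _ (AddSubgroup.disjoint_def.1 hC ⟨s m', ?_⟩ hm)
      exact (map_nsmul s p m').symm
    · intro y
      have hsoc : ∀ y : B ⧸ C, p • y = 0 → ∃ m, σ m = y := by
        intro y hy
        obtain ⟨x, hx, rfl⟩ := mem_of_essential_of_prime_nsmul_eq_zero hess hp hy
        obtain ⟨m, rfl⟩ := hV x hx
        exact ⟨_, rfl⟩
      obtain ⟨x, rfl⟩ := QuotientAddGroup.mk'_surjective C y
      obtain ⟨m, hm⟩ := hV (p • x) ⟨x, rfl⟩
      obtain ⟨m', hm'⟩ := hsoc (q x - σ m) (by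
        rw [nsmul_sub, ← map_nsmul, ← map_nsmul, ← hm]; exact sub_self _)
      exact ⟨m' + m, by rw [map_add, hm', sub_add_cancel]⟩
  exact ⟨C, I, hI, ⟨(AddEquiv.ofBijective σ hσ).symm⟩⟩

theorem IsSuperGeneralizedCoBassian.finite_multiples {G : Type*} {B : Type u} [AddCommGroup G]
    [AddCommGroup B] (hG : IsSuperGeneralizedCoBassian G) {p : ℕ} (hp : p.Prime)
    {f : G →+ B} (hf : Surjective f) (hB : ∀ b : B, p • p • b = 0) :
    Finite (multiplesSubgroup p B) := by
  by_contra hfin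
  have : Infinite (multiplesSubgroup p B) := not_finite_iff_infinite.1 hfin
  have : Fact p.Prime := ⟨hp⟩
  let : Module (ZMod p) (multiplesSubgroup p B) := AddCommGroup.zmodModule (by
    rintro ⟨_, b, rfl⟩
    exact Subtype.ext (hB b))
  let : Module (ZMod (p ^ 2)) B := AddCommGroup.zmodModule (by
    intro b
    rw [pow_two, mul_smul, hB])
  obtain ⟨C, I, _, ⟨e⟩⟩ := exists_quotient_equiv_finsupp hp (multiplesSubgroup p B) rfl
  exact hG.not_surjective_finsupp hp
    (e.toAddMonoidHom.comp ((QuotientAddGroup.mk' C).comp f))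
    (e.surjective.comp ((QuotientAddGroup.mk'_surjective C).comp hf))

theorem finite_span_int_of_torsion {A : Type*} [AddCommGroup A] {X : Set A} (hX : X.Finite) {n : ℕ}
    (hn : n ≠ 0) (h : ∀ x ∈ X, n • x = 0) : Finite (Submodule.span ℤ X) := by
  have : Module.Finite ℤ (Submodule.span ℤ X) := Module.Finite.span_of_finite ℤ hX
  have hle : Submodule.span ℤ X ≤ Submodule.torsionBy ℤ A (n : ℤ) :=
    Submodule.span_le.2 fun x hx => by simpa using h x hx
  refine Module.finite_of_fg_torsion _ ?_
  intro x
  exact ⟨⟨n, by simpa using hn⟩, Subtype.ext (hle x.2)⟩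

/-! ### Necessity: the primary components, and the classification. -/

/-- In a super generalized co-Bassian group with `p`-primary component `P`, the group `p P / p ^ 2 P`
is finite. -/
theorem IsSuperGeneralizedCoBassian.exists_finite_nsmul {G : Type u} [AddCommGroup G]
    (hG : IsSuperGeneralizedCoBassian G) {p : ℕ} (hp : p.Prime) :
    ∃ X : Set G, X.Finite ∧ X ⊆ AddCommGroup.primaryComponent G p ∧
      ∀ x ∈ AddCommGroup.primaryComponent G p, ∃ x' ∈ X,
        ∃ g ∈ AddCommGroup.primaryComponent G p, p • x = p • x' + p • p • g := by
  let K : AddSubgroup G := multiplesSubgroup (p * p) G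
  have hfin := hG.finite_multiples hp (QuotientAddGroup.mk'_surjective K) fun b => by
    obtain ⟨b, rfl⟩ := QuotientAddGroup.mk'_surjective K b
    rw [← map_nsmul, ← map_nsmul]
    exact (QuotientAddGroup.eq_zero_iff _).2 ⟨b, mul_smul p p b⟩
  let P := AddCommGroup.primaryComponent G p
  let t : G → G ⧸ K := fun x => ((p • x : G) : G ⧸ K)
  have ht : (t '' P).Finite := (Set.toFinite (multiplesSubgroup p (G ⧸ K) : Set (G ⧸ K))).subset (by
    rintro _ ⟨x, -, rfl⟩
    exact ⟨x, rfl⟩)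
  obtain ⟨X, hXP, hX⟩ := Set.exists_subset_bijOn (P : Set G) t
  refine ⟨X, Set.Finite.of_finite_image (hX.image_eq ▸ ht) hX.injOn, hXP, fun x hx => ?_⟩
  obtain ⟨x', hx', hxx⟩ := hX.surjOn ⟨x, hx, rfl⟩
  obtain ⟨g, hg⟩ := QuotientAddGroup.eq.1 hxx
  have hg : (p * p) • g = -(p • x') + p • x := hg
  have hgP : (p * p) • g ∈ P :=
    hg ▸ P.add_mem (P.neg_mem (P.nsmul_mem (hXP hx') p)) (P.nsmul_mem hx p)
  obtain ⟨k, hk⟩ := hgP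
  exact ⟨x', hx', g, ⟨k + 2, by rwa [pow_add, pow_two, mul_smul]⟩, by
    rw [← mul_smul, hg, add_neg_cancel_left]⟩

theorem IsSuperGeneralizedCoBassian.hasFinitePRank_primaryComponent {G : Type u} [AddCommGroup G]
    (hG : IsSuperGeneralizedCoBassian G) {p : ℕ} (hp : p.Prime)
    (hdiv : ¬ IsDivisibleGroup (AddCommGroup.primaryComponent G p)) :
    HasFinitePRank p (multiplesSubgroup p (AddCommGroup.primaryComponent G p)) := by
  let P := AddCommGroup.primaryComponent G p
  have hPmem : ∀ x, x ∈ P ↔ ∃ k : ℕ, p ^ k • x = 0 := fun x => Iff.rfl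
  have hPp : ∀ x, p • x ∈ P → x ∈ P := by
    rintro x ⟨k, hk⟩
    exact ⟨k + 1, by rwa [pow_succ, mul_smul]⟩
  obtain ⟨x₀, hx₀⟩ : ∃ x : G, ∀ y, p • y ≠ x := by
    by_contra! h
    refine hdiv (isDivisibleGroup_of_primary hp (fun d => d.2.imp fun k hk => Subtype.ext hk) ?_)
    rintro ⟨x, hx⟩
    obtain ⟨y, rfl⟩ := h x
    exact ⟨⟨y, hPp y hx⟩, rfl⟩
  obtain ⟨X, hX, hXP, hXG⟩ := hG.exists_finite_nsmul hp
  obtain ⟨k, hk⟩ : ∃ k : ℕ, ∀ x ∈ X, p ^ k • x = 0 := by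
    choose! e he using fun x (hx : x ∈ X) => (hPmem x).1 (hXP hx)
    refine ⟨hX.toFinset.sup e, fun x hx => ?_⟩
    obtain ⟨j, hj⟩ := Nat.exists_eq_add_of_le' (Finset.le_sup (f := e) (hX.mem_toFinset.2 hx))
    rw [hj, pow_add, mul_smul, he x hx, smul_zero]
  -- Multiplying `p • x = p • x' + p • p • g` by `p ^ k` kills `x'`, so `p ^ (k + 1) P = p ^ (k + 2)
  -- P`. The divisible `D` is then a retract of `G` and has finite socle.
  let D : AddSubgroup G := P.map (nsmulAddMonoidHom (p ^ (k + 1)))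
  have hDP : D ≤ P := by
    rintro _ ⟨x, hx, rfl⟩
    exact P.nsmul_mem hx _
  have hD : IsDivisibleGroup D := by
    refine isDivisibleGroup_of_primary hp (fun d => (hDP d.2).imp fun k hk => Subtype.ext hk) ?_
    rintro ⟨_, x, hx, rfl⟩
    obtain ⟨x', hx', g, hg, h⟩ := hXG x hx
    refine ⟨⟨_, g, hg, rfl⟩, Subtype.ext ?_⟩
    change p • p ^ (k + 1) • g = p ^ (k + 1) • x
    rw [pow_succ, mul_smul _ _ x, h, nsmul_add, smul_comm (p ^ k) p x', hk x' hx', smul_zero,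
      zero_add, mul_smul, smul_comm p (p ^ k)]
  obtain ⟨r, hr⟩ := hD.exists_retraction
  have hsoc := hG.finite_socle hp hx₀ hD (f := r) fun d => ⟨d, hr d⟩
  let F := Submodule.span ℤ X
  have hF : Finite F := finite_span_int_of_torsion hX (pow_ne_zero k hp.ne_zero) hk
  -- Iterating the congruence gives `pP ⊆ F + p ^ (j + 1) P`. For `j = k`, finitely many cosets of
  -- `D` cover `pP`, and each meets the socle in at most a coset of the socle of `D`.
  have hdec : ∀ j : ℕ, ∀ x ∈ P, ∃ f ∈ F, ∃ g ∈ P, p • x = f + p ^ (j + 1) • g := by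
    intro j
    induction j with
    | zero => exact fun x hx => ⟨0, F.zero_mem, x, hx, by simp⟩
    | succ j ih =>
      intro x hx
      obtain ⟨f, hf, g, hg, h⟩ := ih x hx
      obtain ⟨x', hx', g', hg', h'⟩ := hXG g hg
      refine ⟨f + p ^ (j + 1) • x', F.add_mem hf (F.nsmul_mem (Submodule.subset_span hx') _),
        g', hg', ?_⟩
      rw [h, pow_succ _ (j + 1), pow_succ, mul_smul _ _ g, h', nsmul_add, add_assoc]
      simp only [mul_smul]
  have hfin : {x : G | (∃ y ∈ P, x = p • y) ∧ p • x = 0}.Finite := by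
    have hsub : {x : G | (∃ y ∈ P, x = p • y) ∧ p • x = 0} ⊆
        ⋃ f ∈ (F : Set G), {x : G | x - f ∈ D ∧ p • x = 0} := by
      rintro _ ⟨⟨y, hy, rfl⟩, h0⟩
      obtain ⟨f, hf, g, hg, h⟩ := hdec k y hy
      exact Set.mem_biUnion hf ⟨⟨g, hg, by rw [h]; exact (add_sub_cancel_left _ _).symm⟩, h0⟩
    refine ((Set.toFinite (F : Set G)).biUnion fun f _ => ?_).subset hsub
    rcases Set.eq_empty_or_nonempty {x : G | x - f ∈ D ∧ p • x = 0} with he | ⟨z, hz, hz0⟩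
    · rw [he]; exact Set.finite_empty
    · refine (hsoc.image fun d : D => z + (d : G)).subset fun x hx => ?_
      have hxz : x - z ∈ D := by simpa using D.sub_mem hx.1 hz
      exact ⟨⟨x - z, hxz⟩, Subtype.ext (by
        change p • (x - z) = 0
        rw [nsmul_sub, hx.2, hz0, sub_self]), add_sub_cancel _ _⟩
  rw [hasFinitePRank_iff hp]
  refine Set.Finite.of_finite_image (f := fun x : multiplesSubgroup p P => ((x : P) : G))
    (hfin.subset ?_) (Subtype.val_injective.comp Subtype.val_injective).injOn
  rintro _ ⟨⟨_, y, rfl⟩, hy, rfl⟩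
  exact ⟨⟨y, y.2, rfl⟩, congrArg Subtype.val (congrArg Subtype.val hy)⟩

theorem theorem2p5 (G : Type*) [AddCommGroup G] :
    IsSuperGeneralizedCoBassian G ↔
      IsDivisibleGroup G ∨
        ((IsAddTorsionFree (G ⧸ AddCommGroup.torsion G) ∧
            IsDivisibleGroup (G ⧸ AddCommGroup.torsion G) ∧
            HasFiniteRank (G ⧸ AddCommGroup.torsion G)) ∧
          ∀ p : ℕ, p.Prime →
            IsDivisibleGroup (AddCommGroup.primaryComponent G p) ∨
              HasFinitePRank p (multiplesSubgroup p (AddCommGroup.primaryComponent G p))) := by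
  constructor
  · intro hG
    refine or_iff_not_imp_left.2 fun hdiv => ⟨⟨inferInstance, ?_, ?_⟩, fun p hp => ?_⟩
    · exact hG.isDivisibleGroup_quotient_torsion
    · exact hG.hasFiniteRank_quotient_torsion hdiv
    · exact or_iff_not_imp_left.2 (hG.hasFinitePRank_primaryComponent hp)
  · rintro (hdiv | ⟨⟨-, hd, hr⟩, hp⟩)
    · exact hdiv.isSuperGeneralizedCoBassian
    · exact isSuperGeneralizedCoBassian_of_finite_rank hd hr hp
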